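/- Let $(X,\mathcal A,\mu)$ be a $\sigma$-finite measure space with $\mu(X)=\infty$, let $T:X\to X$ be a conservative, ergodic, measure-preserving transformation, and let $Y\in\mathcal A$ with $0<\mu(Y)<\infty$. For an integrable function $u\ge 0$ put $\mu_u(A)=\int_A u\,d\mu$ and let $\hat T u=d(\mu_u\circ T^{-1})/d\mu$ be the transfer operator. For non-negative integrable $H,G$, say that $H$ is *uniformly sweeping for* $G$ if there are $C>0$ and an integer $K\ge 0$ with $C\sum_{k=0}^{K}\hat T^kH\ge G$ a.e. Put $$Y_n=T^{-n}Y\setminus\bigcup_{k=0}^{n-1}T^{-k}Y\ (\text{so } Y_0=Y),\qquad w_n=\mu\Big(\bigcup_{k=0}^{n-1}T^{-k}Y\Big),\qquad Q(s)=\sum_{n\ge0}e^{-ns}(w_{n+1}-w_n)\ (s>0),$$ and $S_n^Y(x)=\sum_{k=1}^n 1_Y(T^kx)$. Assume that (i) $w_n\sim n^{1-\alpha}\ell(n)$ as $n\to\infty$, for some $\alpha\in(0,1)$ and some positive measurable function $\ell:(0,\infty)\to(0,\infty)$ slowly varying at $\infty$ (that is, $\ell(\lambda t)/\ell(t)\to1$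 as $t\to\infty$ for every $\lambda>0$); (ii) the sequence $\Big\{\frac1{w_n}\sum_{k=0}^{n-1}\hat T^k1_{Y_k}\Big\}_{n\ge1}$ is bounded in $L^\infty(\mu)$. Put $a(t)=\dfrac{t}{\Gamma(1+\alpha)\,Q(t^{-1})}$ for $t>0$, and let $G\ge0$ be $\mu$-integrable. Then: (1) If $G$ is uniformly sweeping for $1_Y$, then there is $C_1\in(0,\infty)$ such that, for every sequence $\{\tilde c(n)\}_{n\ge0}$ of positive reals with $\tilde c(n)\to0$ and $\tilde c(n)a(n)\to\infty$ as $n\to\infty$, $$C_1\le\liminf_{n\to\infty}\frac1{\tilde c(n)}\,\mu_G\Big(\frac{S_n^Y}{a(n)}\le\tilde c(n)\Big).$$ (2) If $1_Y$ is uniformly sweeping for $G$, then there is $C_2\in(0,\infty)$ such that, for every sequence $\{\tilde c(n)\}_{n\ge0}$ of positive reals with $\tilde c(n)\to0$ and $\tilde c(n)a(n)\to\infty$ as $n\to\infty$, $$\limsup_{n\to\infty}\frac1{\tilde c(n)}\,\mu_G\Big(\frac{S_n^Y}{a(n)}\le\tilde c(n)\Big)\le C_2.$$ -/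

import Mathlib

open MeasureTheory Filter Topology Asymptotics
open scoped ENNReal NNReal

namespace InfErg

noncomputable section

variable {X : Type*} [MeasurableSpace X]

/-- The measure `μ_u` with density `u` with respect to `μ`. -/
def densityMeasure (μ : Measure X) (u : X → ℝ≥0∞) : Measure X :=
  μ.withDensity u

/-- The transfer operator `u ↦ d(μ_u ∘ T⁻¹)/dμ` on non-negative functions. -/
def transfer (μ : Measure X) (T : X → X) (u : X → ℝ≥0∞) : X → ℝ≥0∞ :=
  ((densityMeasure μ u).map T).rnDeriv μ

/-- The indicator function of `A`, as a non-negative function. -/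
def ind (A : Set X) : X → ℝ≥0∞ :=
  A.indicator 1

/-- `H` is uniformly sweeping for `G`: `C * ∑_{k=0}^K T̂^k H ≥ G` a.e. for some `C > 0` and
some `K ≥ 0`. -/
def UniformlySweeping (μ : Measure X) (T : X → X) (H G : X → ℝ≥0∞) : Prop :=
  ∃ C : ℝ≥0, 0 < C ∧ ∃ K : ℕ,
    ∀ᵐ x ∂μ, G x ≤ C * ∑ k ∈ Finset.range (K + 1), ((transfer μ T)^[k] H) x

/-- A positive measurable function on `(0, ∞)` which is slowly varying at `∞`
(values of `l` outside `(0, ∞)` play no role). -/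
structure SlowlyVarying (l : ℝ → ℝ) : Prop where
  pos : ∀ t : ℝ, 0 < t → 0 < l t
  measurable : Measurable (fun t : Set.Ioi (0 : ℝ) => l t)
  tendsto : ∀ r : ℝ, 0 < r → Tendsto (fun t : ℝ => l (r * t) / l t) atTop (𝓝 1)

/-- `Y_n`: the points whose orbit `x, T x, T² x, …` enters `Y` for the first time at time `n`.
In particular `Y_0 = Y`. -/
def firstEntrance (T : X → X) (Y : Set X) (n : ℕ) : Set X :=
  (T^[n] ⁻¹' Y) \ ⋃ k ∈ Finset.range n, T^[k] ⁻¹' Y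

/-- The wandering rate `w_n = μ(⋃_{k<n} T^{-k} Y)`. -/
def wanderingRate (μ : Measure X) (T : X → X) (Y : Set X) (n : ℕ) : ℝ :=
  μ.real (⋃ k ∈ Finset.range n, T^[k] ⁻¹' Y)

/-- The Laplace transform `Q(s) = ∑_{n≥0} e^{-ns} (w_{n+1} - w_n)`, for `s > 0`. -/
def wanderingLaplace (μ : Measure X) (T : X → X) (Y : Set X) (s : ℝ) : ℝ :=
  ∑' n : ℕ, Real.exp (-(n * s)) * (wanderingRate μ T Y (n + 1) - wanderingRate μ T Y n)

/-- The normalisation `a(t) = t / (Γ(1+α) Q(1/t))`, for `t > 0`. -/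
def normalisation (μ : Measure X) (T : X → X) (Y : Set X) (α t : ℝ) : ℝ :=
  t / (Real.Gamma (1 + α) * wanderingLaplace μ T Y t⁻¹)

/-- The averages `(1 / w_n) ∑_{k<n} T̂^k 1_{Y_k}`, for `n ≥ 1`. -/
def entranceAverage (μ : Measure X) (T : X → X) (Y : Set X) (n : ℕ) (x : X) : ℝ≥0∞ :=
  (∑ k ∈ Finset.range n, ((transfer μ T)^[k] (ind (firstEntrance T Y k))) x) /
    ENNReal.ofReal (wanderingRate μ T Y n)

/-- The occupation time `S_n(x) = ∑_{k=1}^n 1_A(T^k x)`. -/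
def occupationTime (T : X → X) (A : Set X) (n : ℕ) (x : X) : ℝ :=
  ∑ k ∈ Finset.Icc 1 n, A.indicator (fun _ => (1 : ℝ)) (T^[k] x)

/-- The event `{S_n / a(n) ≤ c}`. -/
def smallOccupation (μ : Measure X) (T : X → X) (Y : Set X) (α : ℝ) (n : ℕ) (c : ℝ) : Set X :=
  {x | occupationTime T Y n x / normalisation μ T Y α n ≤ c}

/-- The admissible sequences: positive, with `c(n) → 0` and `c(n) a(n) → ∞`. -/
structure AdmissibleScale (μ : Measure X) (T : X → X) (Y : Set X) (α : ℝ) (c : ℕ → ℝ) : Prop where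
  pos : ∀ n, 0 < c n
  tendsto_zero : Tendsto c atTop (𝓝 0)
  tendsto_atTop : Tendsto (fun n : ℕ => c n * normalisation μ T Y α n) atTop atTop

end

end InfErg

/-! Write φ for the first return time to Y, τ for the induced map, R_n for the part of Y with no
return up to time n, and q_n = μ(R_n). The map τ preserves μ on Y, and w_n is the sum of the q_k
with k < n.

Upper bound. If an orbit from Y has fewer than m visits up to time n, its first m excursions,
truncated at n, have total length at least n. Since min(φ, n) has integral at most w_n over Y,
Markov's inequality bounds the measure of this event by m w_n / n
(`mul_measure_occupationTime_lt_le`).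

Lower bound. If one of the first m excursions is longer than n, there are at most m visits.
Bonferroni bounds the measure of this union below by m q_n minus m² times a bound for pairs. Pairs
are controlled by assumption (ii): a return of length more than n into B is, seen n steps before its
end, a first entrance at time n into B, so its measure is at most M (w_n / n) μ(B)
(`measure_longReturn_inter_le`, `mul_measure_firstEntrance_le`). Regular variation with exponent 1 -
α > 0 gives q_n ≥ δ w_n / n eventually (`exists_mul_wanderingRate_le`).

Scale. Up to constant factors, a(n) is n / w_n (`normalisation_bounds`). With m close to c(n) a(n),
the main terms are of order c(n), and c(n) → 0 makes the Bonferroni correction negligible. Because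
c(n) a(n) → ∞, rounding and bounded shifts of the number of visits cost only constants. Sweeping
then exchanges μ on Y for μ_G: it compares measures along finitely many preimages under T^k, and
passing from x to T^k x loses at most k visits. -/

namespace InfErg

/-! ### First returns and the induced map -/

section Dynamics

variable {X : Type*} (T : X → X) (Y : Set X)

/-- The first return time to `Y` (with value `0` if there is no return). -/
noncomputable def returnTime (x : X) : ℕ :=
  sInf {k | 0 < k ∧ T^[k] x ∈ Y}

/-- The induced map `x ↦ T^{φ(x)} x`, where `φ` is the first return time. -/
noncomputable def inducedMap (x : X) : X :=
  T^[returnTime T Y x] x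

/-- The points of `Y` that do not return to `Y` up to time `n`. -/
def longReturn (n : ℕ) : Set X :=
  {x | x ∈ Y ∧ ∀ j, 0 < j → j ≤ n → T^[j] x ∉ Y}

/-- The points of `Y` whose first return takes place at time `k`, in the set `A`. -/
def returnAt (k : ℕ) (A : Set X) : Set X :=
  {x | x ∈ Y ∧ (∀ j, 0 < j → j < k → T^[j] x ∉ Y) ∧ T^[k] x ∈ A}

variable {T Y}

lemma returnTime_spec {x : X} (h : ∃ k, 0 < k ∧ T^[k] x ∈ Y) :
    0 < returnTime T Y x ∧ T^[returnTime T Y x] x ∈ Y :=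
  Nat.sInf_mem (s := {k | 0 < k ∧ T^[k] x ∈ Y}) h

lemma notMem_of_lt_returnTime {x : X} {j : ℕ} (hj : 0 < j) (h : j < returnTime T Y x) :
    T^[j] x ∉ Y := fun hm =>
  Nat.notMem_of_lt_sInf (s := {k | 0 < k ∧ T^[k] x ∈ Y}) h ⟨hj, hm⟩

lemma longReturn_antitone : Antitone (longReturn T Y) := fun _ _ h _ hx =>
  ⟨hx.1, fun j hj hjm => hx.2 j hj (hjm.trans h)⟩

lemma longReturn_zero : longReturn T Y 0 = Y := by
  ext x
  simp only [longReturn, Set.mem_ofPred_eq, and_iff_left_iff_imp]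
  intro _ j h1 h2
  omega

lemma firstEntrance_zero : firstEntrance T Y 0 = Y := by
  simp [firstEntrance]

lemma mem_firstEntrance {n : ℕ} {x : X} :
    x ∈ firstEntrance T Y n ↔ T^[n] x ∈ Y ∧ ∀ j < n, T^[j] x ∉ Y := by
  simp [firstEntrance]

lemma returnTime_eq_iff {k : ℕ} (hk : 0 < k) {x : X} :
    returnTime T Y x = k ↔ T^[k] x ∈ Y ∧ ∀ j, 0 < j → j < k → T^[j] x ∉ Y := by
  constructor
  · rintro rfl
    have h : ∃ k, 0 < k ∧ T^[k] x ∈ Y := (Nat.nonempty_of_pos_sInf hk)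
    exact ⟨(returnTime_spec h).2, fun j h1 h2 => notMem_of_lt_returnTime h1 h2⟩
  · rintro ⟨h1, h2⟩
    have h : ∃ k, 0 < k ∧ T^[k] x ∈ Y := ⟨k, hk, h1⟩
    obtain ⟨h3, h4⟩ := returnTime_spec h
    refine le_antisymm (Nat.sInf_le ⟨hk, h1⟩) ?_
    by_contra! hlt
    exact h2 _ h3 hlt h4

lemma exists_mem_returnAt {x : X} (hx : x ∈ Y) (h : ∃ k, 0 < k ∧ T^[k] x ∈ Y) {n : ℕ}
    (hn : x ∈ longReturn T Y n) {A : Set X} (hA : inducedMap T Y x ∈ A) :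
    n < returnTime T Y x ∧ x ∈ returnAt T Y (returnTime T Y x) (A ∩ Y) := by
  obtain ⟨h1, h2⟩ := returnTime_spec h
  refine ⟨?_, hx, fun j h1 h2 => notMem_of_lt_returnTime h1 h2, hA, h2⟩
  by_contra! hle
  exact hn.2 _ h1 hle h2

/-! ### Occupation times along the induced map -/

lemma occupationTime_eq_sum_range (n : ℕ) (x : X) :
    occupationTime T Y n x =
      ∑ k ∈ Finset.range n, Y.indicator (fun _ => (1 : ℝ)) (T^[k + 1] x) := by
  rw [occupationTime, Finset.range_eq_Ico,
    Finset.sum_Ico_add' (fun k => Y.indicator (fun _ => (1 : ℝ)) (T^[k] x)) 0 n 1]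
  rfl

lemma occupationTime_add (a b : ℕ) (x : X) :
    occupationTime T Y (a + b) x = occupationTime T Y a x + occupationTime T Y b (T^[a] x) := by
  simp only [occupationTime_eq_sum_range, Finset.sum_range_add]
  congr 1
  refine Finset.sum_congr rfl fun k _ => ?_
  rw [← Function.iterate_add_apply]
  congr 2
  omega

lemma occupationTime_nonneg (n : ℕ) (x : X) : 0 ≤ occupationTime T Y n x :=
  Finset.sum_nonneg fun _ _ => Set.indicator_nonneg (fun _ _ => zero_le_one) _

lemma occupationTime_mono (x : X) : Monotone fun n => occupationTime T Y n x := by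
  intro a b h
  obtain ⟨c, rfl⟩ := Nat.exists_eq_add_of_le h
  simp only [occupationTime_add]
  linarith [occupationTime_nonneg (T := T) (Y := Y) c (T^[a] x)]

lemma occupationTime_le (n : ℕ) (x : X) : occupationTime T Y n x ≤ n := by
  rw [occupationTime_eq_sum_range]
  calc _ ≤ ∑ _k ∈ Finset.range n, (1 : ℝ) :=
        Finset.sum_le_sum fun _ _ => Set.indicator_le_self' (fun _ _ => zero_le_one) _
    _ = n := by simp

lemma occupationTime_eq_zero {n : ℕ} {x : X} (h : ∀ j, 0 < j → j ≤ n → T^[j] x ∉ Y) :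
    occupationTime T Y n x = 0 :=
  Finset.sum_eq_zero fun j hj => by
    rw [Finset.mem_Icc] at hj
    exact Set.indicator_of_notMem (h j hj.1 hj.2) _

/-- The time of the `i`-th return. -/
noncomputable def returnSum (T : X → X) (Y : Set X) (i : ℕ) (x : X) : ℕ :=
  ∑ j ∈ Finset.range i, returnTime T Y ((inducedMap T Y)^[j] x)

lemma iterate_returnSum (i : ℕ) (x : X) :
    T^[returnSum T Y i x] x = (inducedMap T Y)^[i] x := by
  induction i with
  | zero => simp [returnSum]
  | succ i ih =>
    rw [Function.iterate_succ_apply', returnSum, Finset.sum_range_succ, add_comm,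
      Function.iterate_add_apply, ← returnSum, ih]
    rfl

/-- No recurrence is needed: without a return the default value 0 makes the sum empty. -/
lemma occupationTime_returnTime_le (x : X) : occupationTime T Y (returnTime T Y x) x ≤ 1 := by
  rcases hk : returnTime T Y x with _ | k
  · simp [occupationTime]
  · have h0 : occupationTime T Y k x = 0 := occupationTime_eq_zero fun j h1 h2 =>
      notMem_of_lt_returnTime h1 (by omega)
    rw [occupationTime_add, h0, zero_add]
    simpa using occupationTime_le (T := T) (Y := Y) 1 (T^[k] x)

lemma one_le_occupationTime_returnTime {x : X} (h : ∃ k, 0 < k ∧ T^[k] x ∈ Y) :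
    1 ≤ occupationTime T Y (returnTime T Y x) x := by
  obtain ⟨h1, h2⟩ := returnTime_spec h
  obtain ⟨k, hk⟩ := Nat.exists_eq_succ_of_ne_zero h1.ne'
  rw [hk] at h2 ⊢
  rw [Nat.succ_eq_add_one, occupationTime_eq_sum_range, Finset.sum_range_succ,
    Set.indicator_of_mem h2, ← occupationTime_eq_sum_range]
  linarith [occupationTime_nonneg (T := T) (Y := Y) k x]

lemma returnSum_succ (i : ℕ) (x : X) : returnSum T Y (i + 1) x =
    returnSum T Y i x + returnTime T Y ((inducedMap T Y)^[i] x) :=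
  Finset.sum_range_succ _ _

lemma occupationTime_returnSum_le (i : ℕ) (x : X) :
    occupationTime T Y (returnSum T Y i x) x ≤ i := by
  induction i with
  | zero => simp [returnSum, occupationTime]
  | succ i ih =>
    rw [returnSum_succ, occupationTime_add, iterate_returnSum]
    push_cast
    linarith [occupationTime_returnTime_le (T := T) (Y := Y) ((inducedMap T Y)^[i] x)]

lemma le_occupationTime_returnSum {x : X}
    (h : ∀ i, ∃ k, 0 < k ∧ T^[k] ((inducedMap T Y)^[i] x) ∈ Y) (i : ℕ) :
    i ≤ occupationTime T Y (returnSum T Y i x) x := by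
  induction i with
  | zero => simp [returnSum, occupationTime]
  | succ i ih =>
    rw [returnSum_succ, occupationTime_add, iterate_returnSum]
    push_cast
    linarith [one_le_occupationTime_returnTime (h i)]

/-- At most i visits occur up to the start of the long excursion, and none in the n steps that
follow. -/
lemma occupationTime_le_of_mem_longReturn {n i : ℕ} {x : X}
    (h : (inducedMap T Y)^[i] x ∈ longReturn T Y n) : occupationTime T Y n x ≤ i := by
  have h1 := occupationTime_add (T := T) (Y := Y) (returnSum T Y i x) n x
  rw [iterate_returnSum, occupationTime_eq_zero h.2, add_zero] at h1
  have h2 := occupationTime_mono (T := T) (Y := Y) x (Nat.le_add_left n (returnSum T Y i x))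
  simp only at h2
  linarith [occupationTime_returnSum_le (T := T) (Y := Y) i x]

/-- The m-th return comes after time n. Truncating at n is harmless: either one summand already
equals n, or no summand is truncated. -/
lemma le_sum_min_returnTime {x : X} (h : ∀ i, ∃ k, 0 < k ∧ T^[k] ((inducedMap T Y)^[i] x) ∈ Y)
    {n m : ℕ} (hm : occupationTime T Y n x < m) :
    n ≤ ∑ j ∈ Finset.range m, min (returnTime T Y ((inducedMap T Y)^[j] x)) n := by
  have h1 : n < returnSum T Y m x := by
    by_contra! hle
    have := occupationTime_mono (T := T) (Y := Y) x hle
    simp only at this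
    linarith [le_occupationTime_returnSum h m]
  by_cases hex : ∃ j ∈ Finset.range m, n ≤ returnTime T Y ((inducedMap T Y)^[j] x)
  · obtain ⟨j, hj, hn⟩ := hex
    calc n = min (returnTime T Y ((inducedMap T Y)^[j] x)) n := (min_eq_right hn).symm
      _ ≤ _ := Finset.single_le_sum (f := fun j =>
        min (returnTime T Y ((inducedMap T Y)^[j] x)) n) (fun _ _ => Nat.zero_le _) hj
  · push Not at hex
    refine h1.le.trans (Finset.sum_le_sum fun j hj => ?_)
    exact le_min le_rfl (hex j hj).le

lemma occupationTime_le_iterate_add (k n : ℕ) (x : X) :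
    occupationTime T Y n x ≤ occupationTime T Y n (T^[k] x) + k := by
  have h1 := occupationTime_add (T := T) (Y := Y) k n x
  have h2 := occupationTime_mono (T := T) (Y := Y) x (Nat.le_add_left n k)
  simp only at h2
  linarith [occupationTime_le (T := T) (Y := Y) k x]

end Dynamics

/-! ### Measure-theoretic properties -/

section Measure

variable {X : Type*} [MeasurableSpace X] {μ : Measure X} {T : X → X} {Y : Set X}

lemma measurableSet_longReturn (hT : Measurable T) (hY : MeasurableSet Y) (n : ℕ) :
    MeasurableSet (longReturn T Y n) := by
  have : longReturn T Y n = Y ∩ ⋂ j, ⋂ (_ : 0 < j), ⋂ (_ : j ≤ n), (T^[j] ⁻¹' Y)ᶜ := by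
    ext x; simp [longReturn]
  rw [this]
  exact hY.inter (.iInter fun j => .iInter fun _ => .iInter fun _ => (hT.iterate j hY).compl)

lemma measurableSet_returnAt (hT : Measurable T) (hY : MeasurableSet Y) (k : ℕ) {A : Set X}
    (hA : MeasurableSet A) : MeasurableSet (returnAt T Y k A) := by
  have : returnAt T Y k A =
      Y ∩ ((⋂ j, ⋂ (_ : 0 < j), ⋂ (_ : j < k), (T^[j] ⁻¹' Y)ᶜ) ∩ T^[k] ⁻¹' A) := by
    ext x; simp [returnAt]; tauto
  rw [this]
  exact hY.inter ((MeasurableSet.iInter fun j => .iInter fun _ => .iInter fun _ =>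
    (hT.iterate j hY).compl).inter (hT.iterate k hA))

lemma measurableSet_firstEntrance (hT : Measurable T) (hY : MeasurableSet Y) (n : ℕ) :
    MeasurableSet (firstEntrance T Y n) :=
  (hT.iterate n hY).diff (Finset.measurableSet_biUnion _ fun k _ => hT.iterate k hY)

lemma measurable_returnTime (hT : Measurable T) (hY : MeasurableSet Y) :
    Measurable (returnTime T Y) := by
  have hpos : ∀ k, 0 < k → MeasurableSet (returnTime T Y ⁻¹' {k}) := by
    intro k hk
    have : returnTime T Y ⁻¹' {k} =
        T^[k] ⁻¹' Y ∩ ⋂ j, ⋂ (_ : 0 < j), ⋂ (_ : j < k), (T^[j] ⁻¹' Y)ᶜ := by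
      ext x
      simp [returnTime_eq_iff hk]
    rw [this]
    exact (hT.iterate k hY).inter (.iInter fun j => .iInter fun _ => .iInter fun _ =>
      (hT.iterate j hY).compl)
  refine measurable_to_countable' fun k => ?_
  rcases Nat.eq_zero_or_pos k with rfl | hk
  · have : returnTime T Y ⁻¹' {0} = (⋃ k, ⋃ (_ : 0 < k), returnTime T Y ⁻¹' {k})ᶜ := by
      ext x
      simp only [Set.mem_preimage, Set.mem_singleton_iff, Set.mem_compl_iff, Set.mem_iUnion,
        exists_prop, not_exists, not_and]
      exact ⟨fun h i hi => by omega,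
        fun h => by_contra fun h0 => h _ (Nat.pos_of_ne_zero h0) rfl⟩
    rw [this]
    exact (MeasurableSet.iUnion fun k => .iUnion fun hk => hpos k hk).compl
  · exact hpos k hk

lemma measurable_inducedMap (hT : Measurable T) (hY : MeasurableSet Y) :
    Measurable (inducedMap T Y) := by
  have h : Measurable fun p : ℕ × X => T^[p.1] p.2 :=
    measurable_from_prod_countable_right fun k => hT.iterate k
  exact h.comp ((measurable_returnTime hT hY).prodMk measurable_id)

lemma measurable_occupationTime (hT : Measurable T) (hY : MeasurableSet Y) (n : ℕ) :
    Measurable (occupationTime T Y n) := by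
  unfold occupationTime
  exact Finset.measurable_sum _ fun k _ =>
    (measurable_const.indicator hY).comp (hT.iterate k)

/-- Returns to `A` of length more than `n`, pulled back to a common time, are disjoint. -/
lemma sum_returnAt_le (hT : MeasurePreserving T μ μ) (hY : MeasurableSet Y) {A : Set X}
    (hA : MeasurableSet A) (hAY : A ⊆ Y) (n N : ℕ) :
    ∑ k ∈ Finset.Ioc n N, μ (returnAt T Y k A) ≤ μ (firstEntrance T Y n ∩ T^[n] ⁻¹' A) := by
  rcases le_or_gt N n with h | hnN
  · simp [Finset.Ioc_eq_empty_of_le h]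
  have hm := fun k => measurableSet_returnAt hT.measurable hY k hA
  have hF : MeasurableSet (firstEntrance T Y n ∩ T^[n] ⁻¹' A) :=
    (measurableSet_firstEntrance hT.measurable hY n).inter (hT.measurable.iterate n hA)
  calc ∑ k ∈ Finset.Ioc n N, μ (returnAt T Y k A)
      = ∑ k ∈ Finset.Ioc n N, μ (T^[N - k] ⁻¹' returnAt T Y k A) :=
        Finset.sum_congr rfl fun k _ =>
          ((hT.iterate _).measure_preimage (hm k).nullMeasurableSet).symm
    _ = μ (⋃ k ∈ Finset.Ioc n N, T^[N - k] ⁻¹' returnAt T Y k A) := by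
        refine (measure_biUnion_finset ?_ fun k _ => hT.measurable.iterate _ (hm k)).symm
        -- All these excursions end at time N. The start of the shorter one would be a visit to Y
        -- strictly inside the longer one.
        have key : ∀ i j, i ∈ Finset.Ioc n N → j ∈ Finset.Ioc n N → i < j → ∀ x,
            T^[N - i] x ∈ returnAt T Y i A → T^[N - j] x ∈ returnAt T Y j A → False := by
          intro i j hi hj hij x h1 h2
          rw [Finset.mem_Ioc] at hi hj
          refine h2.2.1 (j - i) (by omega) (by omega) ?_
          rw [← Function.iterate_add_apply, show j - i + (N - j) = N - i by omega]
          exact h1.1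
        intro i hi j hj hij
        refine Set.disjoint_left.2 fun x h1 h2 => ?_
        rcases lt_or_gt_of_ne hij with h | h
        · exact key i j hi hj h x h1 h2
        · exact key j i hj hi h x h2 h1
    _ ≤ μ (T^[N - n] ⁻¹' (firstEntrance T Y n ∩ T^[n] ⁻¹' A)) := by
        refine measure_mono (Set.iUnion₂_subset fun k hk x hx => ?_)
        rw [Finset.mem_Ioc] at hk
        have hxA : T^[n] (T^[N - n] x) ∈ A := by
          have := hx.2.2
          rw [← Function.iterate_add_apply] at this ⊢
          rwa [show n + (N - n) = k + (N - k) by omega]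
        -- Since n < k, the last n steps before the end lie strictly inside the excursion, so they
        -- avoid Y.
        refine ⟨mem_firstEntrance.2 ⟨hAY hxA, fun j hj => ?_⟩, hxA⟩
        have := hx.2.1 (k - n + j) (by omega) (by omega)
        rw [← Function.iterate_add_apply] at this ⊢
        rwa [show j + (N - n) = k - n + j + (N - k) by omega]
    _ = μ (firstEntrance T Y n ∩ T^[n] ⁻¹' A) :=
        (hT.iterate _).measure_preimage hF.nullMeasurableSet

lemma ae_exists_return (hT : Conservative T μ) (hY : MeasurableSet Y) :
    ∀ᵐ x ∂μ.restrict Y, ∃ k, 0 < k ∧ T^[k] x ∈ Y := by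
  rw [ae_restrict_iff' hY]
  filter_upwards [hT.ae_mem_imp_frequently_image_mem hY.nullMeasurableSet] with x hx hxY
  obtain ⟨k, hk, hm⟩ := frequently_atTop.1 (hx hxY) 1
  exact ⟨k, hk, hm⟩

/-- Split by the exact return time k > n. This replaces the induced map, whose number of steps
varies, by the fixed iterate T^n, to which the transfer operator applies. -/
lemma measure_longReturn_inter_le (hc : Conservative T μ) (hT : MeasurePreserving T μ μ)
    (hY : MeasurableSet Y) {A : Set X} (hA : MeasurableSet A) (n : ℕ) :
    μ (longReturn T Y n ∩ inducedMap T Y ⁻¹' A) ≤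
      μ (firstEntrance T Y n ∩ T^[n] ⁻¹' (A ∩ Y)) := by
  have hsub : (longReturn T Y n ∩ inducedMap T Y ⁻¹' A : Set X) ≤ᵐ[μ]
      ⋃ k, if n < k then returnAt T Y k (A ∩ Y) else ∅ := by
    filter_upwards [(ae_restrict_iff' hY).1 (ae_exists_return hc hY)] with x hx hmem
    have h : x ∈ longReturn T Y n ∩ inducedMap T Y ⁻¹' A := hmem
    change x ∈ ⋃ k, if n < k then returnAt T Y k (A ∩ Y) else ∅
    obtain ⟨h1, h2⟩ := exists_mem_returnAt (A := A) h.1.1 (hx h.1.1) h.1 h.2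
    refine Set.mem_iUnion.2 ⟨returnTime T Y x, ?_⟩
    rw [if_pos h1]
    exact h2
  refine (measure_mono_ae hsub).trans ((measure_iUnion_le _).trans ?_)
  rw [ENNReal.tsum_eq_iSup_nat]
  refine iSup_le fun N => le_trans ?_
    (sum_returnAt_le hT hY (hA.inter hY) Set.inter_subset_right n N)
  calc ∑ k ∈ Finset.range N, μ (if n < k then returnAt T Y k (A ∩ Y) else ∅)
      = ∑ k ∈ (Finset.range N).filter (n < ·), μ (returnAt T Y k (A ∩ Y)) := by
        rw [Finset.sum_filter]
        refine Finset.sum_congr rfl fun k _ => ?_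
        split_ifs <;> simp
    _ ≤ _ := by
        refine Finset.sum_le_sum_of_subset fun k hk => ?_
        simp only [Finset.mem_filter, Finset.mem_range, Finset.mem_Ioc] at hk ⊢
        omega

/-- The previous bound at n = 0 says that the image measure is dominated by μ on Y; both have the
same finite total mass, so they coincide. -/
lemma measurePreserving_inducedMap (hc : Conservative T μ) (hT : MeasurePreserving T μ μ)
    (hY : MeasurableSet Y) (hYf : μ Y < ∞) :
    MeasurePreserving (inducedMap T Y) (μ.restrict Y) (μ.restrict Y) := by
  have hm := measurable_inducedMap hT.measurable hY
  have : IsFiniteMeasure (μ.restrict Y) := ⟨by simpa using hYf⟩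
  refine ⟨hm, ?_⟩
  refine Measure.eq_of_le_of_measure_univ_eq (Measure.le_iff.2 fun A hA => ?_) ?_
  · rw [Measure.map_apply hm hA, Measure.restrict_apply (hm hA), Measure.restrict_apply hA]
    have := measure_longReturn_inter_le hc hT hY hA 0
    rw [longReturn_zero, firstEntrance_zero] at this
    rw [Set.inter_comm]
    exact this.trans (measure_mono Set.inter_subset_right)
  · rw [Measure.map_apply hm .univ]
    simp

end Measure

section Estimates

variable {X : Type*} [MeasurableSpace X] {μ : Measure X} {T : X → X} {Y : Set X}

/-! ### The wandering rate -/

lemma measurableSet_biUnion_preimage (hT : Measurable T) (hY : MeasurableSet Y) (n : ℕ) :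
    MeasurableSet (⋃ k ∈ Finset.range n, T^[k] ⁻¹' Y) :=
  Finset.measurableSet_biUnion _ fun k _ => hT.iterate k hY

lemma measure_biUnion_preimage_lt_top (hT : MeasurePreserving T μ μ) (hY : MeasurableSet Y)
    (hYf : μ Y < ∞) (n : ℕ) : μ (⋃ k ∈ Finset.range n, T^[k] ⁻¹' Y) < ∞ := by
  refine (measure_biUnion_finset_le _ _).trans_lt (ENNReal.sum_lt_top.2 fun k _ => ?_)
  rwa [(hT.iterate k).measure_preimage hY.nullMeasurableSet]

lemma wanderingRate_zero : wanderingRate μ T Y 0 = 0 := by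
  simp [wanderingRate]

lemma wanderingRate_nonneg (n : ℕ) : 0 ≤ wanderingRate μ T Y n := measureReal_nonneg

/-- A point of the larger union either visits Y at one of the times 1, …, n, which is the preimage
under T of the smaller union, or lies in Y and does not return by time n. -/
lemma wanderingRate_succ_sub (hT : MeasurePreserving T μ μ)
    (hY : MeasurableSet Y) (hYf : μ Y < ∞) (n : ℕ) :
    wanderingRate μ T Y (n + 1) - wanderingRate μ T Y n = μ.real (longReturn T Y n) := by
  have hU := measurableSet_biUnion_preimage hT.measurable hY n
  have hf := measure_biUnion_preimage_lt_top hT hY hYf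
  have h1 : (⋃ k ∈ Finset.range (n + 1), T^[k] ⁻¹' Y) =
      longReturn T Y n ∪ T ⁻¹' (⋃ k ∈ Finset.range n, T^[k] ⁻¹' Y) := by
    ext x
    simp only [Set.mem_iUnion, Finset.mem_range, Set.mem_preimage, exists_prop, Set.mem_union,
      ← Function.iterate_succ_apply]
    constructor
    · rintro ⟨k, hk, hx⟩
      by_cases h : ∃ i < n, T^[i.succ] x ∈ Y
      · exact Or.inr h
      · push Not at h
        have hk0 : k = 0 := by
          by_contra h0
          obtain ⟨j, rfl⟩ := Nat.exists_eq_succ_of_ne_zero h0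
          exact h j (by omega) hx
        subst hk0
        refine Or.inl ⟨hx, fun j h1 h2 => ?_⟩
        obtain ⟨i, rfl⟩ := Nat.exists_eq_succ_of_ne_zero h1.ne'
        exact h i (by omega)
    · rintro (h | ⟨i, hi, hx⟩)
      · exact ⟨0, by omega, h.1⟩
      · exact ⟨i + 1, by omega, hx⟩
  have hd : Disjoint (longReturn T Y n) (T ⁻¹' (⋃ k ∈ Finset.range n, T^[k] ⁻¹' Y)) := by
    refine Set.disjoint_left.2 fun x hx h => ?_
    simp only [Set.mem_iUnion, Finset.mem_range, Set.mem_preimage, exists_prop,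
      ← Function.iterate_succ_apply] at h
    obtain ⟨i, hi, hm⟩ := h
    exact hx.2 _ (Nat.succ_pos i) (by omega) hm
  have hpre : μ (T ⁻¹' (⋃ k ∈ Finset.range n, T^[k] ⁻¹' Y)) =
      μ (⋃ k ∈ Finset.range n, T^[k] ⁻¹' Y) := hT.measure_preimage hU.nullMeasurableSet
  have h2 : wanderingRate μ T Y (n + 1) = μ.real (longReturn T Y n) + wanderingRate μ T Y n := by
    rw [wanderingRate, h1, measureReal_union hd (hT.measurable hU)
      (measure_ne_top_of_subset (fun _ hx => hx.1) hYf.ne) (hpre ▸ (hf n).ne)]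
    congr 1
    rw [measureReal_def, hpre]
    rfl
  linarith

lemma wanderingRate_eq_sum (hT : MeasurePreserving T μ μ) (hY : MeasurableSet Y)
    (hYf : μ Y < ∞) (n : ℕ) :
    wanderingRate μ T Y n = ∑ k ∈ Finset.range n, μ.real (longReturn T Y k) := by
  rw [← sub_zero (wanderingRate μ T Y n), ← wanderingRate_zero (μ := μ) (T := T) (Y := Y),
    ← Finset.sum_range_sub]
  exact Finset.sum_congr rfl fun k _ => wanderingRate_succ_sub hT hY hYf k

lemma measureReal_longReturn_antitone (hYf : μ Y < ∞) :
    Antitone fun n => μ.real (longReturn T Y n) := fun _ _ h =>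
  measureReal_mono (longReturn_antitone h)
    (measure_ne_top_of_subset (fun _ hx => hx.1) hYf.ne)

lemma wanderingRate_pos (hT : MeasurePreserving T μ μ) (hY : MeasurableSet Y)
    (hYp : 0 < μ Y) (hYf : μ Y < ∞) {n : ℕ} (hn : 1 ≤ n) : 0 < wanderingRate μ T Y n := by
  rw [wanderingRate_eq_sum hT hY hYf]
  refine Finset.sum_pos' (fun _ _ => measureReal_nonneg) ⟨0, Finset.mem_range.2 hn, ?_⟩
  rw [longReturn_zero]
  exact ENNReal.toReal_pos hYp.ne' hYf.ne

/-! ### The transfer operator -/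

/-- Integrability of u keeps the image measure finite, so that its Radon–Nikodym derivative is a
genuine density. -/
lemma setLIntegral_transfer [SigmaFinite μ] (hT : MeasurePreserving T μ μ) {u : X → ℝ≥0∞}
    (hu : ∫⁻ x, u x ∂μ ≠ ∞) {A : Set X} (hA : MeasurableSet A) :
    ∫⁻ x in A, transfer μ T u x ∂μ = ∫⁻ x in T ⁻¹' A, u x ∂μ := by
  have : IsFiniteMeasure (densityMeasure μ u) := isFiniteMeasure_withDensity hu
  have hac : (densityMeasure μ u).map T ≪ μ := by
    have h := (withDensity_absolutelyContinuous μ u).map hT.measurable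
    rwa [hT.map_eq] at h
  rw [transfer, Measure.setLIntegral_rnDeriv hac, Measure.map_apply hT.measurable hA,
    densityMeasure, withDensity_apply _ (hT.measurable hA)]

lemma setLIntegral_transfer_iterate [SigmaFinite μ] (hT : MeasurePreserving T μ μ)
    {u : X → ℝ≥0∞} (hu : ∫⁻ x, u x ∂μ ≠ ∞) (k : ℕ) {A : Set X} (hA : MeasurableSet A) :
    ∫⁻ x in A, (transfer μ T)^[k] u x ∂μ = ∫⁻ x in T^[k] ⁻¹' A, u x ∂μ := by
  induction k generalizing A with
  | zero => rfl
  | succ k ih =>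
    have hfin : ∫⁻ x, (transfer μ T)^[k] u x ∂μ ≠ ∞ := by
      have := ih .univ
      simp only [Set.preimage_univ, Measure.restrict_univ] at this
      rwa [this]
    rw [Function.iterate_succ_apply', setLIntegral_transfer hT hfin hA, ih (hT.measurable hA),
      Function.iterate_succ', Set.preimage_comp]

lemma aemeasurable_transfer_iterate {u : X → ℝ≥0∞} (hu : AEMeasurable u μ) (k : ℕ) :
    AEMeasurable ((transfer μ T)^[k] u) μ := by
  cases k with
  | zero => exact hu
  | succ k =>
    rw [Function.iterate_succ_apply']
    exact (Measure.measurable_rnDeriv _ _).aemeasurable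

lemma measurable_ind {A : Set X} (hA : MeasurableSet A) : Measurable (ind A) :=
  measurable_one.indicator hA

lemma setLIntegral_ind {A : Set X} (hA : MeasurableSet A) (B : Set X) :
    ∫⁻ x in B, ind A x ∂μ = μ (A ∩ B) := by
  rw [ind, lintegral_indicator_one hA, Measure.restrict_apply hA]

lemma densityMeasure_ind {A B : Set X} (hA : MeasurableSet A) (hB : MeasurableSet B) :
    densityMeasure μ (ind A) B = μ.restrict A B := by
  rw [densityMeasure, withDensity_apply _ hB, setLIntegral_ind hA, Measure.restrict_apply hB,
    Set.inter_comm]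

/-- Integrate the sweeping inequality over A and move each power of the transfer operator onto the
set by duality. -/
lemma UniformlySweeping.exists_measure_le [SigmaFinite μ] (hT : MeasurePreserving T μ μ)
    {u v : X → ℝ≥0∞} (hu : AEMeasurable u μ) (hui : ∫⁻ x, u x ∂μ ≠ ∞)
    (h : UniformlySweeping μ T u v) :
    ∃ C : ℝ≥0, 0 < C ∧ ∃ K : ℕ, ∀ A : Set X, MeasurableSet A → densityMeasure μ v A ≤
      C * ∑ k ∈ Finset.range (K + 1), densityMeasure μ u (T^[k] ⁻¹' A) := by
  obtain ⟨C, hC, K, h⟩ := h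
  refine ⟨C, hC, K, fun A hA => ?_⟩
  calc densityMeasure μ v A = ∫⁻ x in A, v x ∂μ := withDensity_apply _ hA
    _ ≤ ∫⁻ x in A, C * ∑ k ∈ Finset.range (K + 1), (transfer μ T)^[k] u x ∂μ :=
        lintegral_mono_ae (ae_restrict_of_ae h)
    _ = C * ∑ k ∈ Finset.range (K + 1), densityMeasure μ u (T^[k] ⁻¹' A) := by
        rw [lintegral_const_mul' _ _ ENNReal.coe_ne_top, lintegral_finsetSum' _ fun k _ =>
          (aemeasurable_transfer_iterate hu k).restrict]
        congr 1
        refine Finset.sum_congr rfl fun k _ => ?_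
        rw [setLIntegral_transfer_iterate hT hui k hA, densityMeasure,
          withDensity_apply _ (hT.measurable.iterate k hA)]

/-! ### First entrances under the boundedness assumption -/

lemma measure_firstEntrance_antitone (hT : MeasurePreserving T μ μ) (hY : MeasurableSet Y)
    {A : Set X} (hA : MeasurableSet A) :
    Antitone fun n => μ (firstEntrance T Y n ∩ T^[n] ⁻¹' A) := by
  refine antitone_nat_of_succ_le fun n => ?_
  have hm : MeasurableSet (firstEntrance T Y n ∩ T^[n] ⁻¹' A) :=
    (measurableSet_firstEntrance hT.measurable hY n).inter (hT.measurable.iterate n hA)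
  rw [← hT.measure_preimage hm.nullMeasurableSet]
  refine measure_mono fun x hx => ⟨mem_firstEntrance.2 ⟨?_, fun j hj => ?_⟩, ?_⟩
  · exact (mem_firstEntrance.1 hx.1).1
  · exact (mem_firstEntrance.1 hx.1).2 (j + 1) (by omega)
  · exact hx.2

/-- Assumption (ii) controls only an average over k < n; monotonicity in k turns it into a bound at
time n itself. -/
lemma mul_measure_firstEntrance_le [SigmaFinite μ] (hT : MeasurePreserving T μ μ)
    (hY : MeasurableSet Y) (hYp : 0 < μ Y) (hYf : μ Y < ∞) {M : ℝ≥0} {n : ℕ} (hn : 1 ≤ n)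
    (hM : eLpNorm (entranceAverage μ T Y n) ∞ μ ≤ M) {A : Set X} (hA : MeasurableSet A) :
    n * μ (firstEntrance T Y n ∩ T^[n] ⁻¹' A) ≤
      M * ENNReal.ofReal (wanderingRate μ T Y n) * μ A := by
  have hF := measurableSet_firstEntrance hT.measurable hY
  have hFf : ∀ k, ∫⁻ x, ind (firstEntrance T Y k) x ∂μ ≠ ∞ := fun k => by
    rw [ind, lintegral_indicator_one (hF k)]
    refine measure_ne_top_of_subset 
      (Set.sdiff_subset : firstEntrance T Y k ⊆ T^[k] ⁻¹' Y) ?_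
    rw [(hT.iterate k).measure_preimage hY.nullMeasurableSet]
    exact hYf.ne
  have hae : ∀ᵐ x ∂μ, ∑ k ∈ Finset.range n, (transfer μ T)^[k] (ind (firstEntrance T Y k)) x ≤
      M * ENNReal.ofReal (wanderingRate μ T Y n) := by
    rw [eLpNorm_exponent_top] at hM
    filter_upwards [enorm_ae_le_eLpNormEssSup (entranceAverage μ T Y n) μ] with x hx
    have h := hx.trans hM
    rw [enorm_eq_self, entranceAverage] at h
    exact (ENNReal.div_le_iff_le_mul
      (Or.inl (ENNReal.ofReal_pos.2 (wanderingRate_pos hT hY hYp hYf hn)).ne')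
      (Or.inl ENNReal.ofReal_ne_top)).1 h
  calc (n : ℝ≥0∞) * μ (firstEntrance T Y n ∩ T^[n] ⁻¹' A)
      = ∑ _k ∈ Finset.range n, μ (firstEntrance T Y n ∩ T^[n] ⁻¹' A) := by simp
    _ ≤ ∑ k ∈ Finset.range n, μ (firstEntrance T Y k ∩ T^[k] ⁻¹' A) :=
        Finset.sum_le_sum fun k hk =>
          measure_firstEntrance_antitone hT hY hA (Finset.mem_range.1 hk).le
    _ = ∑ k ∈ Finset.range n,
          ∫⁻ x in A, (transfer μ T)^[k] (ind (firstEntrance T Y k)) x ∂μ :=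
        Finset.sum_congr rfl fun k _ => by
          rw [setLIntegral_transfer_iterate hT (hFf k) k hA, setLIntegral_ind (hF k)]
    _ = ∫⁻ x in A,
          ∑ k ∈ Finset.range n, (transfer μ T)^[k] (ind (firstEntrance T Y k)) x ∂μ :=
        (lintegral_finsetSum' _ fun k _ => (aemeasurable_transfer_iterate
          (measurable_ind (hF k)).aemeasurable k).restrict).symm
    _ ≤ ∫⁻ _x in A, M * ENNReal.ofReal (wanderingRate μ T Y n) ∂μ :=
        lintegral_mono_ae (ae_restrict_of_ae hae)
    _ = _ := by simp

/-! ### Upper bound for small occupation times -/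

/-- Layer-cake formula: min(φ, n) is the sum over k < n of the indicators of {φ > k}. -/
lemma lintegral_min_returnTime_le (hT : MeasurePreserving T μ μ) (hY : MeasurableSet Y)
    (hYf : μ Y < ∞) (n : ℕ) :
    ∫⁻ x, ((min (returnTime T Y x) n : ℕ) : ℝ≥0∞) ∂μ.restrict Y ≤
      ENNReal.ofReal (wanderingRate μ T Y n) := by
  have hm : ∀ k, MeasurableSet {x | k < returnTime T Y x} := fun k =>
    measurable_returnTime hT.measurable hY measurableSet_Ioi
  have hpt : ∀ x, ((min (returnTime T Y x) n : ℕ) : ℝ≥0∞) =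
      ∑ k ∈ Finset.range n, ind {x | k < returnTime T Y x} x := by
    intro x
    have : ∀ k, ind {x | k < returnTime T Y x} x = if k < returnTime T Y x then 1 else 0 :=
      fun k => by simp [ind, Set.indicator_apply]
    simp only [this]
    rw [← Finset.sum_filter, Finset.sum_const, nsmul_one]
    congr 1
    have : (Finset.range n).filter (· < returnTime T Y x) =
        Finset.range (min (returnTime T Y x) n) := by
      ext k
      simp only [Finset.mem_filter, Finset.mem_range, lt_min_iff]
      tauto
    rw [this, Finset.card_range]
  simp only [hpt]
  rw [lintegral_finsetSum _ fun k _ => measurable_ind (hm k), wanderingRate_eq_sum hT hY hYf,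
    ENNReal.ofReal_sum_of_nonneg fun _ _ => measureReal_nonneg]
  refine Finset.sum_le_sum fun k _ => ?_
  rw [ofReal_measureReal (measure_ne_top_of_subset (fun _ hx => hx.1) hYf.ne),
    setLIntegral_ind (hm k)]
  exact measure_mono fun x hx => ⟨hx.2, fun j h1 h2 =>
    notMem_of_lt_returnTime h1 (lt_of_le_of_lt h2 hx.1)⟩

lemma mul_measure_occupationTime_lt_le (hc : Conservative T μ) (hT : MeasurePreserving T μ μ)
    (hY : MeasurableSet Y) (hYf : μ Y < ∞) (n m : ℕ) :
    n * μ.restrict Y {x | occupationTime T Y n x < m} ≤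
      m * ENNReal.ofReal (wanderingRate μ T Y n) := by
  have hτ := measurePreserving_inducedMap hc hT hY hYf
  have hret : ∀ᵐ x ∂μ.restrict Y, ∀ i, ∃ k, 0 < k ∧ T^[k] ((inducedMap T Y)^[i] x) ∈ Y :=
    ae_all_iff.2 fun i => (hτ.iterate i).quasiMeasurePreserving.ae (ae_exists_return hc hY)
  have hmin : Measurable fun x => ((min (returnTime T Y x) n : ℕ) : ℝ≥0∞) :=
    (measurable_of_countable fun k : ℕ => ((min k n : ℕ) : ℝ≥0∞)).comp
      (measurable_returnTime hT.measurable hY)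
  have hS : MeasurableSet {x | occupationTime T Y n x < m} :=
    measurable_occupationTime hT.measurable hY n measurableSet_Iio
  calc (n : ℝ≥0∞) * μ.restrict Y {x | occupationTime T Y n x < m}
      = ∫⁻ _x in {x | occupationTime T Y n x < m}, n ∂μ.restrict Y := by
        rw [setLIntegral_const]
    _ ≤ ∫⁻ x in {x | occupationTime T Y n x < m}, ∑ j ∈ Finset.range m,
          ((min (returnTime T Y ((inducedMap T Y)^[j] x)) n : ℕ) : ℝ≥0∞) ∂μ.restrict Y := by
        refine lintegral_mono_ae ((ae_restrict_iff' hS).2 ?_)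
        filter_upwards [hret] with x hx hxS
        exact_mod_cast le_sum_min_returnTime hx hxS
    _ ≤ ∫⁻ x, ∑ j ∈ Finset.range m,
          ((min (returnTime T Y ((inducedMap T Y)^[j] x)) n : ℕ) : ℝ≥0∞) ∂μ.restrict Y :=
        setLIntegral_le_lintegral _ _
    _ = ∑ _j ∈ Finset.range m,
          ∫⁻ x, ((min (returnTime T Y x) n : ℕ) : ℝ≥0∞) ∂μ.restrict Y := by
        refine (lintegral_finsetSum _ fun j _ => hmin.comp (hτ.iterate j).measurable).trans ?_
        exact Finset.sum_congr rfl fun j _ => (hτ.iterate j).lintegral_comp hmin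
    _ ≤ ∑ _j ∈ Finset.range m, ENNReal.ofReal (wanderingRate μ T Y n) :=
        Finset.sum_le_sum fun _ _ => lintegral_min_returnTime_le hT hY hYf n
    _ = _ := by simp

/-! ### Lower bound for small occupation times -/

/-- Bonferroni by induction: the m-th set meets the earlier union in measure at most m b, and m² + m
≤ (m + 1)². -/
lemma measureReal_biUnion_ge (ν : Measure X) [IsFiniteMeasure ν] {A : ℕ → Set X}
    (hA : ∀ i, MeasurableSet (A i)) {p b : ℝ} (hb : 0 ≤ b) (hp : ∀ i, ν.real (A i) = p)
    (hpair : ∀ i j, i < j → ν.real (A i ∩ A j) ≤ b) (m : ℕ) :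
    m * p - m ^ 2 * b ≤ ν.real (⋃ i ∈ Finset.range m, A i) := by
  induction m with
  | zero => simp
  | succ m ih =>
    have hU : MeasurableSet (⋃ i ∈ Finset.range m, A i) :=
      Finset.measurableSet_biUnion _ fun i _ => hA i
    have h1 := measureReal_union_add_inter (μ := ν) (s := A m) hU
      (measure_ne_top _ _) (measure_ne_top _ _)
    have h2 : ν.real (A m ∩ ⋃ i ∈ Finset.range m, A i) ≤ m * b := by
      calc ν.real (A m ∩ ⋃ i ∈ Finset.range m, A i)
          = ν.real (⋃ i ∈ Finset.range m, A i ∩ A m) := by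
            congr 1
            rw [Set.inter_comm, Set.iUnion₂_inter]
        _ ≤ ∑ i ∈ Finset.range m, ν.real (A i ∩ A m) := measureReal_biUnion_finset_le _ _
        _ ≤ ∑ _i ∈ Finset.range m, b :=
            Finset.sum_le_sum fun i hi => hpair i m (Finset.mem_range.1 hi)
        _ = m * b := by simp
    rw [Finset.range_add_one, Finset.set_biUnion_insert]
    rw [hp m] at h1
    push_cast
    nlinarith

lemma le_measureReal_occupationTime_le [SigmaFinite μ] (hc : Conservative T μ)
    (hT : MeasurePreserving T μ μ) (hY : MeasurableSet Y) (hYp : 0 < μ Y) (hYf : μ Y < ∞)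
    {M : ℝ≥0} {n : ℕ} (hn : 1 ≤ n)
    (hM : eLpNorm (entranceAverage μ T Y n) ∞ μ ≤ M) (m : ℕ) :
    m * μ.real (longReturn T Y n) * (1 - m * (M * (wanderingRate μ T Y n / n))) ≤
      (μ.restrict Y).real {x | occupationTime T Y n x ≤ m} := by
  have hτ := measurePreserving_inducedMap hc hT hY hYf
  have hR := measurableSet_longReturn hT.measurable hY n
  have : IsFiniteMeasure (μ.restrict Y) := ⟨by simpa using hYf⟩
  have hRr : (μ.restrict Y).real (longReturn T Y n) = μ.real (longReturn T Y n) := by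
    rw [measureReal_def, measureReal_def, Measure.restrict_apply hR,
      Set.inter_eq_left.2 fun _ hx => hx.1]
  have hinv : ∀ (i : ℕ) {B : Set X}, MeasurableSet B →
      (μ.restrict Y).real ((inducedMap T Y)^[i] ⁻¹' B) = (μ.restrict Y).real B :=
    fun i B hB => by
      rw [measureReal_def, (hτ.iterate i).measure_preimage hB.nullMeasurableSet]; rfl
  have hn0 : (0 : ℝ) < n := by exact_mod_cast hn
  have hw0 := wanderingRate_nonneg (μ := μ) (T := T) (Y := Y) n
  have hpair : ∀ i j, i < j → (μ.restrict Y).real ((inducedMap T Y)^[i] ⁻¹' longReturn T Y n ∩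
      (inducedMap T Y)^[j] ⁻¹' longReturn T Y n) ≤
      M * (wanderingRate μ T Y n / n) * μ.real (longReturn T Y n) := by
    intro i j hij
    -- With j = i + d + 1, invariance removes the first i steps; one induced step then leads from a
    -- long excursion into B, and B has the same measure in Y as R_n.
    obtain ⟨d, rfl⟩ := Nat.exists_eq_add_of_lt hij
    set B := (inducedMap T Y)^[d] ⁻¹' longReturn T Y n with hB
    have hBm : MeasurableSet B := (hτ.iterate d).measurable hR
    have hset : (inducedMap T Y)^[i] ⁻¹' longReturn T Y n ∩
        (inducedMap T Y)^[i + d + 1] ⁻¹' longReturn T Y n =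
        (inducedMap T Y)^[i] ⁻¹' (longReturn T Y n ∩ inducedMap T Y ⁻¹' B) := by
      ext x
      simp only [hB, Set.mem_inter_iff, Set.mem_preimage, ← Function.iterate_succ_apply,
        ← Function.iterate_add_apply]
      rw [show d.succ + i = i + d + 1 by omega]
    have hRB : MeasurableSet (longReturn T Y n ∩ inducedMap T Y ⁻¹' B) :=
      hR.inter (hτ.measurable hBm)
    rw [hset, hinv i hRB]
    have h1 := mul_measure_firstEntrance_le hT hY hYp hYf hn hM (hBm.inter hY)
    have h2 := measure_longReturn_inter_le hc hT hY hBm n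
    have h3 : μ (B ∩ Y) = μ (longReturn T Y n) := by
      rw [← Measure.restrict_apply hBm, hB,
        (hτ.iterate d).measure_preimage hR.nullMeasurableSet, Measure.restrict_apply hR,
        Set.inter_eq_left.2 fun _ hx => hx.1]
    have h4 : (n : ℝ≥0∞) * (μ.restrict Y) (longReturn T Y n ∩ inducedMap T Y ⁻¹' B) ≤
        M * ENNReal.ofReal (wanderingRate μ T Y n) * μ (longReturn T Y n) := by
      rw [h3] at h1
      refine le_trans ?_ h1
      exact mul_le_mul_right ((Measure.restrict_apply_le _ _).trans h2) _
    have hfin : μ (longReturn T Y n) ≠ ∞ :=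
      measure_ne_top_of_subset (fun _ hx => hx.1) hYf.ne
    have h5 := ENNReal.toReal_mono (by finiteness) h4
    simp only [ENNReal.toReal_mul, ENNReal.toReal_natCast, ENNReal.coe_toReal,
      ENNReal.toReal_ofReal hw0] at h5
    rw [← measureReal_def, ← measureReal_def] at h5
    rw [← mul_div_assoc, div_mul_eq_mul_div, le_div_iff₀ hn0]
    linarith
  have hbon := measureReal_biUnion_ge (μ.restrict Y)
    (A := fun i => (inducedMap T Y)^[i] ⁻¹' longReturn T Y n)
    (fun i => (hτ.iterate i).measurable hR) (by positivity)
    (fun i => (hinv i hR).trans hRr) hpair m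
  refine le_trans (le_of_eq ?_) (hbon.trans (measureReal_mono ?_))
  · ring
  · refine Set.iUnion₂_subset fun i hi x hx => ?_
    have h1 := occupationTime_le_of_mem_longReturn (T := T) (Y := Y) (x := x) hx
    have h2 : (i : ℝ) ≤ m := by exact_mod_cast (Finset.mem_range.1 hi).le
    exact h1.trans h2

end Estimates

section Asymptotic

variable {X : Type*} [MeasurableSpace X] {μ : Measure X} {T : X → X} {Y : Set X}

/-! ### Comparison of the normalisation with the wandering rate -/

lemma mul_longReturn_le_wanderingRate (hT : MeasurePreserving T μ μ) (hY : MeasurableSet Y)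
    (hYf : μ Y < ∞) (n : ℕ) : n * μ.real (longReturn T Y n) ≤ wanderingRate μ T Y n := by
  rw [wanderingRate_eq_sum hT hY hYf]
  calc n * μ.real (longReturn T Y n)
      = ∑ _k ∈ Finset.range n, μ.real (longReturn T Y n) := by simp
    _ ≤ _ := Finset.sum_le_sum fun k hk =>
        measureReal_longReturn_antitone hYf (Finset.mem_range.1 hk).le

lemma one_div_one_sub_exp_neg_inv_le {n : ℕ} (hn : 1 ≤ n) :
    (1 - Real.exp (-(n : ℝ)⁻¹))⁻¹ ≤ 2 * n := by
  have hn0 : (1 : ℝ) ≤ n := by exact_mod_cast hn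
  have h1 : (n : ℝ)⁻¹ + 1 ≤ Real.exp (n : ℝ)⁻¹ := Real.add_one_le_exp _
  have h2 : Real.exp (-(n : ℝ)⁻¹) ≤ ((n : ℝ)⁻¹ + 1)⁻¹ := by
    rw [Real.exp_neg]
    exact inv_anti₀ (by positivity) h1
  have h3 : ((n : ℝ)⁻¹ + 1)⁻¹ = 1 - ((n : ℝ) + 1)⁻¹ := by
    field_simp
    ring
  have h4 : ((n : ℝ) + 1)⁻¹ ≤ 1 - Real.exp (-(n : ℝ)⁻¹) := by linarith
  calc (1 - Real.exp (-(n : ℝ)⁻¹))⁻¹ ≤ (((n : ℝ) + 1)⁻¹)⁻¹ := inv_anti₀ (by positivity) h4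
    _ ≤ 2 * n := by rw [inv_inv]; linarith

/-- Two-sided bounds replace a Tauberian theorem. From below, the weights with k < n are at least
1/e ≥ 1/3. From above, the terms with k < n sum to at most w_n; beyond, q_k ≤ w_n / n, and the
geometric series adds at most 2 w_n. -/
lemma wanderingLaplace_inv_bounds (hT : MeasurePreserving T μ μ) (hY : MeasurableSet Y)
    (hYf : μ Y < ∞) {n : ℕ} (hn : 1 ≤ n) :
    wanderingRate μ T Y n ≤ 3 * wanderingLaplace μ T Y (n : ℝ)⁻¹ ∧
      wanderingLaplace μ T Y (n : ℝ)⁻¹ ≤ 3 * wanderingRate μ T Y n := by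
  have hn0 : (0 : ℝ) < n := by exact_mod_cast hn
  have hw0 := wanderingRate_nonneg (μ := μ) (T := T) (Y := Y) n
  have hmul := mul_longReturn_le_wanderingRate hT hY hYf n
  have hanti := measureReal_longReturn_antitone (T := T) hYf
  have hwsum := wanderingRate_eq_sum hT hY hYf n
  set w := wanderingRate μ T Y n
  set q : ℕ → ℝ := fun k => μ.real (longReturn T Y k)
  set r := Real.exp (-(n : ℝ)⁻¹)
  have hq0 : ∀ k, 0 ≤ q k := fun _ => measureReal_nonneg
  have hr0 : 0 ≤ r := (Real.exp_pos _).le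
  have hr1 : r < 1 := Real.exp_zero ▸ Real.exp_lt_exp.2 (by simpa using hn0)
  have hQ : wanderingLaplace μ T Y (n : ℝ)⁻¹ = ∑' k : ℕ, r ^ k * q k := by
    refine tsum_congr fun k => ?_
    rw [wanderingRate_succ_sub hT hY hYf, ← Real.exp_nat_mul, mul_neg]
  have hbound : HasSum (fun k => (if k ∈ Finset.range n then q k else 0) + r ^ k * (w / n))
      (w + (1 - r)⁻¹ * (w / n)) := by
    refine HasSum.add ?_ ((hasSum_geometric_of_lt_one hr0 hr1).mul_right _)
    have h := hasSum_sum_of_ne_finset_zero (L := .unconditional ℕ) (s := Finset.range n)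
      (f := fun k => if k ∈ Finset.range n then q k else 0) fun k hk => if_neg hk
    rwa [Finset.sum_congr rfl fun k hk => if_pos hk, ← hwsum] at h
  have hle : ∀ k, r ^ k * q k ≤ (if k ∈ Finset.range n then q k else 0) + r ^ k * (w / n) := by
    intro k
    have hrk : 0 ≤ r ^ k := pow_nonneg hr0 k
    split_ifs with hk
    · have h1 : r ^ k * q k ≤ q k := mul_le_of_le_one_left (hq0 k) (pow_le_one₀ hr0 hr1.le)
      have h2 : 0 ≤ r ^ k * (w / n) := by positivity
      linarith
    · rw [zero_add]
      refine mul_le_mul_of_nonneg_left ?_ hrk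
      rw [le_div_iff₀ hn0, mul_comm]
      exact (mul_le_mul_of_nonneg_left (hanti (by simpa using hk)) hn0.le).trans hmul
  have hsum : Summable fun k => r ^ k * q k :=
    Summable.of_nonneg_of_le (fun k => mul_nonneg (pow_nonneg hr0 k) (hq0 k)) hle hbound.summable
  rw [hQ]
  constructor
  · have h3 : (1 : ℝ) / 3 ≤ Real.exp (-1) := by
      rw [Real.exp_neg, one_div]
      exact inv_anti₀ (Real.exp_pos 1) (by linarith [Real.exp_one_lt_d9])
    have h1 : 1 / 3 * w ≤ ∑' k, r ^ k * q k := by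
      calc 1 / 3 * w = ∑ k ∈ Finset.range n, 1 / 3 * q k := by rw [hwsum, Finset.mul_sum]
        _ ≤ ∑ k ∈ Finset.range n, r ^ k * q k := by
          refine Finset.sum_le_sum fun k hk => mul_le_mul_of_nonneg_right (h3.trans ?_) (hq0 k)
          rw [← Real.exp_nat_mul, Real.exp_le_exp, mul_neg, neg_le_neg_iff,
            ← div_eq_mul_inv, div_le_one hn0]
          exact_mod_cast (Finset.mem_range.1 hk).le
        _ ≤ _ := hsum.sum_le_tsum _ fun k _ => mul_nonneg (pow_nonneg hr0 k) (hq0 k)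
    linarith
  · have h1 : ∑' k, r ^ k * q k ≤ w + (1 - r)⁻¹ * (w / n) :=
      (hsum.tsum_le_tsum hle hbound.summable).trans_eq hbound.tsum_eq
    have h2 : (1 - r)⁻¹ * (w / n) ≤ 2 * n * (w / n) :=
      mul_le_mul_of_nonneg_right (one_div_one_sub_exp_neg_inv_le hn) (by positivity)
    have h3 : 2 * n * (w / n) = 2 * w := by field_simp
    linarith

lemma normalisation_bounds (hT : MeasurePreserving T μ μ) (hY : MeasurableSet Y)
    (hYp : 0 < μ Y) (hYf : μ Y < ∞) {α : ℝ} (hα : 0 < α) {n : ℕ} (hn : 1 ≤ n) :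
    0 < normalisation μ T Y α n ∧
      1 / (3 * Real.Gamma (1 + α)) ≤
        normalisation μ T Y α n * (wanderingRate μ T Y n / n) ∧
      normalisation μ T Y α n * (wanderingRate μ T Y n / n) ≤ 3 / Real.Gamma (1 + α) := by
  have hn0 : (0 : ℝ) < n := by exact_mod_cast hn
  have hΓ : 0 < Real.Gamma (1 + α) := Real.Gamma_pos_of_pos (by linarith)
  obtain ⟨h1, h2⟩ := wanderingLaplace_inv_bounds hT hY hYf hn
  have hw := wanderingRate_pos hT hY hYp hYf hn
  have hQ : 0 < wanderingLaplace μ T Y (n : ℝ)⁻¹ := by linarith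
  have heq : normalisation μ T Y α n * (wanderingRate μ T Y n / n) =
      wanderingRate μ T Y n / (Real.Gamma (1 + α) * wanderingLaplace μ T Y (n : ℝ)⁻¹) := by
    rw [normalisation]
    field_simp
  refine ⟨div_pos hn0 (mul_pos hΓ hQ), ?_, ?_⟩
  · rw [heq, div_le_div_iff₀ (by positivity) (by positivity)]
    nlinarith
  · rw [heq, div_le_div_iff₀ (by positivity) (by positivity)]
    nlinarith

/-! ### Regular variation of the wandering rate -/

/-- The ratio w_{2n} / w_n tends to 2^(1 - α) > 1, while monotonicity of q gives w_{2n} - w_n ≤ n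
q_n. -/
lemma exists_mul_wanderingRate_le (hT : MeasurePreserving T μ μ) (hY : MeasurableSet Y)
    (hYp : 0 < μ Y) (hYf : μ Y < ∞) {α : ℝ} (hα : α < 1) {l : ℝ → ℝ} (hl : SlowlyVarying l)
    (hw : (fun n : ℕ => wanderingRate μ T Y n) ~[atTop]
      (fun n : ℕ => (n : ℝ) ^ (1 - α) * l n)) :
    ∃ δ : ℝ, 0 < δ ∧ ∀ᶠ n : ℕ in atTop,
      δ * wanderingRate μ T Y n ≤ n * μ.real (longReturn T Y n) := by
  have hL : (1 : ℝ) < 2 ^ (1 - α) := Real.one_lt_rpow one_lt_two (by linarith)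
  have hdouble : Tendsto (fun n : ℕ => 2 * n) atTop atTop :=
    tendsto_id.const_mul_atTop' two_pos
  have heq := (hw.comp_tendsto hdouble).div hw
  have hlim : Tendsto (fun n : ℕ => ((2 * n : ℕ) : ℝ) ^ (1 - α) * l (2 * n : ℕ) /
      ((n : ℝ) ^ (1 - α) * l n)) atTop (𝓝 (2 ^ (1 - α))) := by
    have h1 := ((hl.tendsto 2 two_pos).comp tendsto_natCast_atTop_atTop).const_mul
      ((2 : ℝ) ^ (1 - α))
    rw [mul_one] at h1
    refine h1.congr' ?_
    filter_upwards [eventually_ge_atTop 1] with n hn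
    have hn0 : (0 : ℝ) < n := by exact_mod_cast hn
    have hp : (0 : ℝ) < (n : ℝ) ^ (1 - α) := Real.rpow_pos_of_pos hn0 _
    have hln := hl.pos n hn0
    simp only [Function.comp_apply, Nat.cast_mul, Nat.cast_ofNat]
    rw [Real.mul_rpow two_pos.le hn0.le]
    field_simp
  have hratio : Tendsto (fun n : ℕ => wanderingRate μ T Y (2 * n) / wanderingRate μ T Y n)
      atTop (𝓝 (2 ^ (1 - α))) := heq.symm.tendsto_nhds hlim
  -- Half the gap between the limit and 1, since the ratio eventually exceeds their midpoint.
  refine ⟨(2 ^ (1 - α) - 1) / 2, by linarith, ?_⟩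
  filter_upwards [hratio.eventually (lt_mem_nhds (show (2 ^ (1 - α) + 1) / 2 < (2 : ℝ) ^ (1 - α)
    by linarith)), eventually_ge_atTop 1] with n hn hn1
  have hwp := wanderingRate_pos hT hY hYp hYf hn1
  rw [lt_div_iff₀ hwp] at hn
  have hsum : wanderingRate μ T Y (2 * n) ≤
      wanderingRate μ T Y n + n * μ.real (longReturn T Y n) := by
    rw [wanderingRate_eq_sum hT hY hYf, wanderingRate_eq_sum hT hY hYf, two_mul,
      Finset.sum_range_add]
    refine add_le_add_right ?_ _
    calc ∑ k ∈ Finset.range n, μ.real (longReturn T Y (n + k))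
        ≤ ∑ _k ∈ Finset.range n, μ.real (longReturn T Y n) :=
          Finset.sum_le_sum fun k _ => measureReal_longReturn_antitone hYf (Nat.le_add_right n k)
      _ = _ := by simp
  linarith

/-! ### Small occupation times starting from `Y` -/

lemma AdmissibleScale.eventually_measure_le (hc : Conservative T μ)
    (hT : MeasurePreserving T μ μ) (hY : MeasurableSet Y) (hYp : 0 < μ Y) (hYf : μ Y < ∞)
    {α : ℝ} (hα : 0 < α) {c : ℕ → ℝ} (h : AdmissibleScale μ T Y α c) (K : ℕ) :
    ∀ᶠ n : ℕ in atTop,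
      μ.restrict Y {x | occupationTime T Y n x ≤ c n * normalisation μ T Y α n + K} ≤
        ENNReal.ofReal (6 / Real.Gamma (1 + α) * c n) := by
  filter_upwards [eventually_ge_atTop 1,
    h.tendsto_atTop.eventually_ge_atTop ((K : ℝ) + 1)] with n hn hs
  have hn0 : (0 : ℝ) < n := by exact_mod_cast hn
  have hcn := h.pos n
  obtain ⟨-, -, ha⟩ := normalisation_bounds hT hY hYp hYf hα hn
  have hw0 := wanderingRate_nonneg (μ := μ) (T := T) (Y := Y) n
  set s := c n * normalisation μ T Y α n with hs_def
  have hs0 : 0 ≤ s := by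
    have : (0 : ℝ) ≤ K := K.cast_nonneg
    linarith
  -- The smallest integer of this form strictly above s + K; it stays below 2 s because s ≥ K + 1.
  set m := ⌊s⌋₊ + K + 1 with hm
  have hm1 : s + K < m := by
    rw [hm]; push_cast; linarith [Nat.lt_floor_add_one s]
  have hm2 : (m : ℝ) ≤ 2 * s := by
    rw [hm]; push_cast; linarith [Nat.floor_le hs0]
  have hmain := mul_measure_occupationTime_lt_le hc hT hY hYf n m
  have hw : (m : ℝ≥0∞) * ENNReal.ofReal (wanderingRate μ T Y n) =
      n * ENNReal.ofReal (m * (wanderingRate μ T Y n / n)) := by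
    rw [← ENNReal.ofReal_natCast, ← ENNReal.ofReal_natCast, ← ENNReal.ofReal_mul (by positivity),
      ← ENNReal.ofReal_mul (by positivity)]
    congr 1
    field_simp
  rw [hw, ENNReal.mul_le_mul_iff_right (by exact_mod_cast hn0.ne') (by simp)] at hmain
  refine (measure_mono fun x hx => lt_of_le_of_lt hx hm1).trans
    (hmain.trans (ENNReal.ofReal_le_ofReal ?_))
  calc m * (wanderingRate μ T Y n / n) ≤ 2 * s * (wanderingRate μ T Y n / n) :=
        mul_le_mul_of_nonneg_right hm2 (by positivity)
    _ = 2 * c n * (normalisation μ T Y α n * (wanderingRate μ T Y n / n)) := by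
        rw [hs_def]; ring
    _ ≤ 2 * c n * (3 / Real.Gamma (1 + α)) := mul_le_mul_of_nonneg_left ha (by positivity)
    _ = _ := by ring

lemma exists_eventually_le_measure [SigmaFinite μ] (hc : Conservative T μ)
    (hT : MeasurePreserving T μ μ) (hY : MeasurableSet Y) (hYp : 0 < μ Y) (hYf : μ Y < ∞)
    {α : ℝ} (hα : 0 < α) {M : ℝ≥0}
    (hM : ∀ n : ℕ, 1 ≤ n → eLpNorm (entranceAverage μ T Y n) ∞ μ ≤ M) {δ : ℝ} (hδ : 0 < δ)
    (hδw : ∀ᶠ n : ℕ in atTop, δ * wanderingRate μ T Y n ≤ n * μ.real (longReturn T Y n)) :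
    ∃ D : ℝ, 0 < D ∧ ∀ c : ℕ → ℝ, AdmissibleScale μ T Y α c → ∀ K : ℕ, ∀ᶠ n : ℕ in atTop,
      ENNReal.ofReal (D * c n) ≤
        μ.restrict Y {x | occupationTime T Y n x ≤ c n * normalisation μ T Y α n - K} := by
  have hΓ : 0 < Real.Gamma (1 + α) := Real.Gamma_pos_of_pos (by linarith)
  -- The 12 collects 2 from m ≥ s / 2, 2 from the Bonferroni factor, and 3 from the lower bound on
  -- a(n) w_n / n. The constant does not depend on c or K.
  refine ⟨δ / (12 * Real.Gamma (1 + α)), by positivity, fun c h K => ?_⟩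
  have hlim : Tendsto (fun n => c n * (3 * M / Real.Gamma (1 + α))) atTop (𝓝 0) := by
    simpa using h.tendsto_zero.mul_const (3 * (M : ℝ) / Real.Gamma (1 + α))
  filter_upwards [eventually_ge_atTop 1, hδw,
    h.tendsto_atTop.eventually_ge_atTop (2 * ((K : ℝ) + 1)),
    hlim.eventually (gt_mem_nhds (show (0 : ℝ) < 1 / 2 by norm_num))] with n hn hδn hs hsmall
  have : IsFiniteMeasure (μ.restrict Y) := ⟨by simpa using hYf⟩
  have hn0 : (0 : ℝ) < n := by exact_mod_cast hn
  have hK : (0 : ℝ) ≤ K := K.cast_nonneg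
  have hM0 : (0 : ℝ) ≤ M := M.coe_nonneg
  have hcn := h.pos n
  obtain ⟨-, ha1, ha2⟩ := normalisation_bounds hT hY hYp hYf hα hn
  have hw0 := wanderingRate_nonneg (μ := μ) (T := T) (Y := Y) n
  have hq0 : 0 ≤ μ.real (longReturn T Y n) := measureReal_nonneg
  set s := c n * normalisation μ T Y α n with hs_def
  set m := ⌊s - K⌋₊ with hm
  have hm1 : (m : ℝ) ≤ s - K := Nat.floor_le (by linarith)
  have hm2 : s / 2 ≤ m := by linarith [Nat.lt_floor_add_one (s - K)]
  have hmain := le_measureReal_occupationTime_le hc hT hY hYp hYf hn (hM n hn) m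
  have hbad : m * (M * (wanderingRate μ T Y n / n)) ≤ 1 / 2 := by
    calc m * (M * (wanderingRate μ T Y n / n))
        ≤ s * (M * (wanderingRate μ T Y n / n)) :=
          mul_le_mul_of_nonneg_right (by linarith) (by positivity)
      _ = c n * M * (normalisation μ T Y α n * (wanderingRate μ T Y n / n)) := by
          rw [hs_def]; ring
      _ ≤ c n * M * (3 / Real.Gamma (1 + α)) := mul_le_mul_of_nonneg_left ha2 (by positivity)
      _ = c n * (3 * M / Real.Gamma (1 + α)) := by ring
      _ ≤ 1 / 2 := hsmall.le
  have hq : δ * (wanderingRate μ T Y n / n) ≤ μ.real (longReturn T Y n) := by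
    rw [← mul_div_assoc, div_le_iff₀ hn0]
    linarith
  rw [← ofReal_measureReal (measure_ne_top _ _)]
  refine ENNReal.ofReal_le_ofReal (le_trans ?_ (hmain.trans (measureReal_mono fun x hx =>
    le_trans hx hm1)))
  calc δ / (12 * Real.Gamma (1 + α)) * c n
      = δ / 4 * c n * (1 / (3 * Real.Gamma (1 + α))) := by field_simp; norm_num
    _ ≤ δ / 4 * c n * (normalisation μ T Y α n * (wanderingRate μ T Y n / n)) :=
        mul_le_mul_of_nonneg_left ha1 (by positivity)
    _ = s / 2 * (δ * (wanderingRate μ T Y n / n)) * (1 / 2) := by rw [hs_def]; ring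
    _ ≤ m * μ.real (longReturn T Y n) *
          (1 - m * (M * (wanderingRate μ T Y n / n))) := by
        refine mul_le_mul (mul_le_mul hm2 hq (by positivity) (by positivity)) (by linarith)
          (by norm_num) (by positivity)

lemma smallOccupation_eq {α : ℝ} {n : ℕ} (ha : 0 < normalisation μ T Y α n) (s : ℝ) :
    smallOccupation μ T Y α n s = {x | occupationTime T Y n x ≤ s * normalisation μ T Y α n} := by
  ext x
  exact div_le_iff₀ ha

end Asymptotic

end InfErg

/-! ### Passage from Y to G by uniform sweeping -/

open InfErg in
theorem mainTheorem7 {X : Type*} [MeasurableSpace X] (μ : Measure X) [SigmaFinite μ]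
    (hμ : μ Set.univ = ∞) (T : X → X) (hcons : Conservative T μ) (herg : Ergodic T μ)
    (Y : Set X) (hY : MeasurableSet Y) (hY_pos : 0 < μ Y) (hY_fin : μ Y < ∞)
    (α : ℝ) (hα : α ∈ Set.Ioo (0 : ℝ) 1) (l : ℝ → ℝ) (hl : InfErg.SlowlyVarying l)
    (hw : (fun n : ℕ => InfErg.wanderingRate μ T Y n) ~[atTop]
      (fun n : ℕ => (n : ℝ) ^ (1 - α) * l n))
    (hbdd : ∃ M : ℝ≥0, ∀ n : ℕ, 1 ≤ n →
      eLpNorm (InfErg.entranceAverage μ T Y n) ∞ μ ≤ M)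
    (G : X → ℝ) (hG : Integrable G μ) (hG_nonneg : 0 ≤ᵐ[μ] G) :
    (InfErg.UniformlySweeping μ T (fun x => ENNReal.ofReal (G x)) (InfErg.ind Y) →
      ∃ C₁ : ℝ, 0 < C₁ ∧ ∀ c : ℕ → ℝ, InfErg.AdmissibleScale μ T Y α c →
        ENNReal.ofReal C₁ ≤ liminf (fun n : ℕ =>
          InfErg.densityMeasure μ (fun x => ENNReal.ofReal (G x))
            (InfErg.smallOccupation μ T Y α n (c n)) / ENNReal.ofReal (c n)) atTop) ∧
    (InfErg.UniformlySweeping μ T (InfErg.ind Y) (fun x => ENNReal.ofReal (G x)) →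
      ∃ C₂ : ℝ, 0 < C₂ ∧ ∀ c : ℕ → ℝ, InfErg.AdmissibleScale μ T Y α c →
        limsup (fun n : ℕ =>
          InfErg.densityMeasure μ (fun x => ENNReal.ofReal (G x))
            (InfErg.smallOccupation μ T Y α n (c n)) / ENNReal.ofReal (c n)) atTop
          ≤ ENNReal.ofReal C₂) := by
  obtain ⟨hα0, hα1⟩ := hα
  have hT : MeasurePreserving T μ μ := herg.toMeasurePreserving
  have hΓ : 0 < Real.Gamma (1 + α) := Real.Gamma_pos_of_pos (by linarith)
  have hmeas : ∀ (n : ℕ) (s : ℝ), MeasurableSet {x | occupationTime T Y n x ≤ s} := fun n s =>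
    measurable_occupationTime hT.measurable hY n measurableSet_Iic
  constructor
  · intro hsw
    obtain ⟨C, hC, K, hCK⟩ := hsw.exists_measure_le hT hG.aemeasurable.ennreal_ofReal
      hG.lintegral_lt_top.ne
    obtain ⟨M, hM⟩ := hbdd
    obtain ⟨δ, hδ, hδw⟩ := exists_mul_wanderingRate_le hT hY hY_pos hY_fin hα1 hl hw
    obtain ⟨D, hD, hlow⟩ := exists_eventually_le_measure hcons hT hY hY_pos hY_fin hα0 hM hδ hδw
    have hC' : (0 : ℝ) < C := hC
    refine ⟨D / (C * (K + 1)), by positivity, fun c hc => le_liminf_of_le (by isBoundedDefault) ?_⟩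
    filter_upwards [eventually_ge_atTop 1, hlow c hc K] with n hn hle
    have ha := (normalisation_bounds hT hY hY_pos hY_fin hα0 hn).1
    have hcn := hc.pos n
    rw [smallOccupation_eq ha, ENNReal.le_div_iff_mul_le
      (Or.inl (ENNReal.ofReal_pos.2 hcn).ne') (Or.inl ENNReal.ofReal_ne_top)]
    set s := c n * normalisation μ T Y α n
    set E := densityMeasure μ (fun x => ENNReal.ofReal (G x)) {x | occupationTime T Y n x ≤ s}
    have h1 : ENNReal.ofReal (D * c n) ≤ ENNReal.ofReal (C * (K + 1)) * E := by
      calc ENNReal.ofReal (D * c n) ≤ _ := hle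
        _ = densityMeasure μ (ind Y) {x | occupationTime T Y n x ≤ s - K} :=
            (densityMeasure_ind hY (hmeas n _)).symm
        _ ≤ C * ∑ k ∈ Finset.range (K + 1), densityMeasure μ (fun x => ENNReal.ofReal (G x))
              (T^[k] ⁻¹' {x | occupationTime T Y n x ≤ s - K}) := hCK _ (hmeas n _)
        _ ≤ C * ∑ _k ∈ Finset.range (K + 1), E := by
            -- The level was lowered by K so that every preimage with k ≤ K lies in the event at
            -- level s.
            refine mul_le_mul_right (Finset.sum_le_sum fun k hk => measure_mono fun x hx => ?_) _
            have h2 : (k : ℝ) ≤ K := by exact_mod_cast Nat.lt_succ_iff.1 (Finset.mem_range.1 hk)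
            have h3 := occupationTime_le_iterate_add (T := T) (Y := Y) k n x
            have h4 : occupationTime T Y n (T^[k] x) ≤ s - K := hx
            change occupationTime T Y n x ≤ s
            linarith
        _ = ENNReal.ofReal (C * (K + 1)) * E := by
            rw [Finset.sum_const, Finset.card_range, nsmul_eq_mul,
              ENNReal.ofReal_mul hC'.le, ENNReal.ofReal_coe_nnreal, mul_assoc]
            congr 2
            rw [← ENNReal.ofReal_natCast]
            push_cast
            rfl
    have hCK0 : 0 < (C : ℝ) * (K + 1) := by positivity
    rw [← ENNReal.ofReal_mul (by positivity)]
    refine (ENNReal.mul_le_mul_iff_right (ENNReal.ofReal_pos.2 hCK0).ne'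
      ENNReal.ofReal_ne_top).1 (le_trans (le_of_eq ?_) h1)
    rw [← ENNReal.ofReal_mul hCK0.le]
    congr 1
    field_simp
  · intro hsw
    have hYint : ∫⁻ x, ind Y x ∂μ ≠ ∞ := by
      rw [ind, lintegral_indicator_one hY]
      exact hY_fin.ne
    obtain ⟨C, hC, K, hCK⟩ := hsw.exists_measure_le hT (measurable_ind hY).aemeasurable hYint
    have hC' : (0 : ℝ) < C := hC
    refine ⟨C * (K + 1) * (6 / Real.Gamma (1 + α)), by positivity,
      fun c hc => limsup_le_of_le (by isBoundedDefault) ?_⟩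
    filter_upwards [eventually_ge_atTop 1,
      hc.eventually_measure_le hcons hT hY hY_pos hY_fin hα0 K] with n hn hle
    have ha := (normalisation_bounds hT hY hY_pos hY_fin hα0 hn).1
    have hcn := hc.pos n
    rw [smallOccupation_eq ha]
    set s := c n * normalisation μ T Y α n
    refine ENNReal.div_le_of_le_mul ?_
    calc densityMeasure μ (fun x => ENNReal.ofReal (G x)) {x | occupationTime T Y n x ≤ s}
        ≤ C * ∑ k ∈ Finset.range (K + 1), densityMeasure μ (ind Y)
            (T^[k] ⁻¹' {x | occupationTime T Y n x ≤ s}) := hCK _ (hmeas n _)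
      _ ≤ C * ∑ _k ∈ Finset.range (K + 1), ENNReal.ofReal (6 / Real.Gamma (1 + α) * c n) := by
          -- Here the level rises by at most K, which the estimate on Y allows for.
          refine mul_le_mul_right (Finset.sum_le_sum fun k hk => ?_) _
          rw [densityMeasure_ind hY (hT.measurable.iterate k (hmeas n _))]
          refine (measure_mono fun x hx => ?_).trans hle
          have h2 : (k : ℝ) ≤ K := by exact_mod_cast Nat.lt_succ_iff.1 (Finset.mem_range.1 hk)
          have h3 := occupationTime_le_iterate_add (T := T) (Y := Y) k n x
          have h4 : occupationTime T Y n (T^[k] x) ≤ s := hx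
          change occupationTime T Y n x ≤ s + K
          linarith
      _ = ENNReal.ofReal (C * (K + 1) * (6 / Real.Gamma (1 + α))) * ENNReal.ofReal (c n) := by
          rw [Finset.sum_const, Finset.card_range, nsmul_eq_mul, ← ENNReal.ofReal_coe_nnreal,
            ← ENNReal.ofReal_natCast, ← ENNReal.ofReal_mul (by positivity),
            ← ENNReal.ofReal_mul (by positivity), ← ENNReal.ofReal_mul (by positivity)]
          congr 1
          push_cast
          ring
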